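/- Let $V>0$ (visibility range) and $\sigma>0$ (step-size limit) be real numbers, and let $n$ agents move in the Euclidean plane $\mathbb{R}^2$ in discrete time; $p_i(k)$ is the position of agent $i$ at time-step $k=0,1,2,\dots$. The neighbours of agent $i$ at time-step $k$ are $N_i(k)=\{\,j\neq i : \|p_i(k)-p_j(k)\|\le V\,\}$, and the neighbourhood graph at time-step $k$ joins $i$ and $j$ iff $j\in N_i(k)$. Let $c_i(k)$ be the centre of the smallest circle enclosing $p_i(k)$ and all $p_j(k)$, $j\in N_i(k)$. Put $$Goal_i(k)=\|p_i(k)-c_i(k)\|,\qquad Limit_{ij}(k)=\frac{l_{ij}(k)}{2}\cos\theta_{ij}(k)+\sqrt{\Big(\frac V2\Big)^2-\Big(\frac{l_{ij}(k)}{2}\Big)^2\sin^2\theta_{ij}(k)}\quad (j\in N_i(k)),$$ where $l_{ij}(k)=\|p_j(k)-p_i(k)\|$ and $\theta_{ij}(k)$ is the angle at $p_i(k)$ between the directions to $c_i(k)$ and to $p_j(k)$ (so $Limit_{ij}(k)$ is the largest distance that agent $i$ can move straight towards $c_i(k)$ inside the closed disc of radius $V/2$ centred at the midpoint of $p_i(k)$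 and $p_j(k)$). All agents move simultaneously according to $$p_i(k+1)=p_i(k)+Step_i(k)\,\frac{c_i(k)-p_i(k)}{\|c_i(k)-p_i(k)\|},\qquad Step_i(k)=\min\Big\{\sigma,\ Goal_i(k),\ \min_{j\in N_i(k)}Limit_{ij}(k)\Big\},$$ where an agent with $p_i(k)=c_i(k)$ stays put, $p_i(k+1)=p_i(k)$, and an agent without neighbours has no limit term. Then, for every initial constellation $p_1(0),\dots,p_n(0)$ whose neighbourhood graph is connected, all agents gather to a single point within finitely many time-steps: there are a point $q\in\mathbb{R}^2$ and a time-step $K$ such that $p_i(k)=q$ for all $k\ge K$ and all agents $i$. -/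

import Mathlib

noncomputable section

namespace AndoGathering

/-- The Euclidean plane in which the agents move. -/
abbrev Plane : Type := EuclideanSpace ℝ (Fin 2)

/-- A constellation of `n` agents: agent `i` is located at `p i`. Two agents may share a position. -/
abbrev Constellation (n : ℕ) : Type := Fin n → Plane

/-- The circle with centre `c` and radius `r` is the smallest circle enclosing the set `S`: the
closed disc it bounds contains `S`, and no closed disc of smaller radius contains `S`. -/
def IsSmallestEnclosingCircle (S : Set Plane) (c : Plane) (r : ℝ) : Prop :=
  0 ≤ r ∧ S ⊆ Metric.closedBall c r ∧
    ∀ (c' : Plane) (r' : ℝ), 0 ≤ r' → S ⊆ Metric.closedBall c' r' → r ≤ r'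

/-- A nonempty finite set of points has exactly one smallest enclosing circle. -/
theorem existsUnique_smallestEnclosingCircle (S : Finset Plane) (hS : S.Nonempty) :
    ∃! cr : Plane × ℝ, IsSmallestEnclosingCircle (S : Set Plane) cr.1 cr.2 := by
  obtain ⟨a, ha⟩ := hS
  have hcont : Continuous fun c : Plane => S.sup' ⟨a, ha⟩ fun x => dist x c :=
    Continuous.finset_sup'_apply _ fun x _ => continuous_const.dist continuous_id
  have hlim : Filter.Tendsto (fun c : Plane => S.sup' ⟨a, ha⟩ fun x => dist x c)
      (Filter.cocompact Plane) Filter.atTop :=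
    Filter.tendsto_atTop_mono
      (fun c => Finset.le_sup' (fun x => dist x c) ha) (tendsto_dist_left_cocompact_atTop a)
  obtain ⟨c, hc⟩ := hcont.exists_forall_le hlim
  obtain ⟨r, hr⟩ : ∃ r, r = S.sup' ⟨a, ha⟩ fun x => dist x c := ⟨_, rfl⟩
  have hdist : ∀ x ∈ S, dist x c ≤ r := fun x hx =>
    hr ▸ Finset.le_sup' (fun x => dist x c) hx
  have hsub : (S : Set Plane) ⊆ Metric.closedBall c r := fun x hx =>
    Metric.mem_closedBall.2 (hdist x hx)
  have hr0 : 0 ≤ r := dist_nonneg.trans (hdist a ha)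
  have hmain : IsSmallestEnclosingCircle (S : Set Plane) c r :=
    ⟨hr0, hsub, fun c' r' _ h => hr ▸ (hc c').trans
      (Finset.sup'_le _ _ fun x hx => Metric.mem_closedBall.1 (h hx))⟩
  refine ⟨(c, r), hmain, ?_⟩
  rintro ⟨c', r'⟩ ⟨h0', hsub', hmin'⟩
  obtain rfl : r' = r := le_antisymm (hmin' c _ hr0 hsub) (hmain.2.2 c' r' h0' hsub')
  have hcc : c' = c := by
    by_contra hne
    have hd : 0 < ‖c' - c‖ := norm_pos_iff.2 (sub_ne_zero.2 hne)
    have hkey : ∀ x ∈ S, dist x ((2 : ℝ)⁻¹ • (c + c')) ^ 2 ≤ r' ^ 2 - ‖c' - c‖ ^ 2 / 4 := by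
      intro x hx
      have h1 : ‖x - c‖ ≤ r' := by simpa [dist_eq_norm] using hsub hx
      have h2 : ‖x - c'‖ ≤ r' := by simpa [dist_eq_norm] using hsub' hx
      have h3 := parallelogram_law_with_norm ℝ (x - c) (x - c')
      have h4 : x - c + (x - c') = (2 : ℝ) • (x - (2 : ℝ)⁻¹ • (c + c')) := by module
      have h5 : x - c - (x - c') = c' - c := by abel
      rw [h4, h5, norm_smul] at h3
      simp only [Real.norm_ofNat] at h3
      rw [dist_eq_norm]
      nlinarith [norm_nonneg (x - c), norm_nonneg (x - c')]
    have hle : r' ≤ √(r' ^ 2 - ‖c' - c‖ ^ 2 / 4) :=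
      hmin' ((2 : ℝ)⁻¹ • (c + c')) _ (Real.sqrt_nonneg _) fun x hx =>
        Metric.mem_closedBall.2 (Real.le_sqrt_of_sq_le (hkey x hx))
    have hnn : 0 ≤ r' ^ 2 - ‖c' - c‖ ^ 2 / 4 := (sq_nonneg _).trans (hkey a ha)
    have := pow_le_pow_left₀ h0' hle 2
    rw [Real.sq_sqrt hnn] at this
    nlinarith
  rw [hcc]

/-- Agents `i` and `j` see each other iff they are distinct and at distance at most `V`. -/
def visibilityGraph {n : ℕ} (V : ℝ) (p : Constellation n) : SimpleGraph (Fin n) where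
  Adj i j := i ≠ j ∧ dist (p i) (p j) ≤ V
  symm := ⟨fun i j h => ⟨h.1.symm, by rw [dist_comm]; exact h.2⟩⟩
  loopless := ⟨fun _ h => h.1 rfl⟩

open Classical in
/-- The set `N_i` of neighbours of agent `i`; the agent itself does not belong to it. -/
def neighbours {n : ℕ} (V : ℝ) (p : Constellation n) (i : Fin n) : Finset (Fin n) :=
  Finset.univ.filter fun j => (visibilityGraph V p).Adj i j

open Classical in
/-- The positions of agent `i` and of all its neighbours. -/
def localPositions {n : ℕ} (V : ℝ) (p : Constellation n) (i : Fin n) : Finset Plane :=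
  (insert i (neighbours V p i)).image p

theorem localPositions_nonempty {n : ℕ} (V : ℝ) (p : Constellation n) (i : Fin n) :
    (localPositions V p i).Nonempty :=
  (Finset.insert_nonempty _ _).image _

/-- `c_i`: the centre of the smallest circle enclosing agent `i` and all its neighbours. -/
def center {n : ℕ} (V : ℝ) (p : Constellation n) (i : Fin n) : Plane :=
  (existsUnique_smallestEnclosingCircle _ (localPositions_nonempty V p i)).choose.1

/-- `Goal_i`: the distance of agent `i` from `c_i`. -/
def goal {n : ℕ} (V : ℝ) (p : Constellation n) (i : Fin n) : ℝ :=
  ‖p i - center V p i‖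

/-- `Limit_ij = (l/2) cos θ + √((V/2)² - (l/2)² sin² θ)`, where `l` is the distance between agents
`i` and `j` and `θ` is the angle at `p i` between the directions to `c_i` and to `p j`. It is the
largest distance that agent `i` can move towards `c_i` inside the closed disc of radius `V / 2`
about the midpoint of `p i` and `p j`. (The angle is irrelevant when `p j = p i`.) -/
def limitPair {n : ℕ} (V : ℝ) (p : Constellation n) (i j : Fin n) : ℝ :=
  let l := ‖p j - p i‖
  let θ := EuclideanGeometry.angle (center V p i) (p i) (p j)
  l / 2 * Real.cos θ + √((V / 2) ^ 2 - (l / 2) ^ 2 * Real.sin θ ^ 2)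

open Classical in
/-- `Step_i`: the least element of the set consisting of `σ`, of `Goal_i` and of the numbers
`Limit_ij` for all neighbours `j` of agent `i`. -/
def step {n : ℕ} (V σ : ℝ) (p : Constellation n) (i : Fin n) : ℝ :=
  (insert σ (insert (goal V p i) ((neighbours V p i).image (limitPair V p i)))).min'
    (Finset.insert_nonempty _ _)

/-- The next position of agent `i`: it moves by `Step_i` in the direction of `c_i`. An agent that
already is at `c_i` stays there (the displacement below is then `0`). -/
def nextPosition {n : ℕ} (V σ : ℝ) (p : Constellation n) (i : Fin n) : Plane :=
  p i + (step V σ p i / ‖center V p i - p i‖) • (center V p i - p i)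

/-- The sequence `p 0, p 1, p 2, …` of constellations follows the synchronous discrete-time
dynamics with visibility range `V` and step-size limit `σ`. -/
def IsTrajectory {n : ℕ} (V σ : ℝ) (p : ℕ → Constellation n) : Prop :=
  ∀ (k : ℕ) (i : Fin n), p (k + 1) i = nextPosition V σ (p k) i

end AndoGathering

end

/-! No edge of the visibility graph is ever lost, so the graph is eventually a constant connected
graph `G`. The greatest distance `‖p k‖` from the origin never increases, because each centre lies
in every origin-centred disc containing all agents.

The update map is not continuous: visibility can jump, and so can the direction to the centre. Hence
a compactness argument extracts limits of whole tails of the trajectory together with centres, radii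
and ratios. The limits obey only the weaker relation `IsMove G`, but that suffices
(`isMove_of_tendsto`), and their greatest norm is constant. An agent of greatest norm after such a
move did not move and coincided with its `G`-neighbours (`IsMove.norm_lt_or`); finiteness and
connectedness then force a gathered limit. So the agents come arbitrarily close, and one more step
merges them (`nextPosition_eq_of_close`). -/

namespace AndoGathering

open Filter Topology

/-! ### Smallest enclosing circles -/

/-- The smallest enclosing circle of a set that lies in a closed disc has its centre in the
interior of that disc, unless its radius is `0`. -/
theorem IsSmallestEnclosingCircle.norm_center_lt {S : Set Plane} {c : Plane} {r R : ℝ}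
    (h : IsSmallestEnclosingCircle S c r) (hr : 0 < r) (hS : ∀ x ∈ S, ‖x‖ ≤ R) : ‖c‖ < R := by
  obtain ⟨-, hsub, hmin⟩ := h
  by_contra! hc
  -- If `‖c‖ ≥ R`, shrinking `c` to `(1 - ε) • c` gives an enclosing circle of squared radius `(1 -
  -- ε) r² + ε² ‖c‖²`, below `r²` exactly because `ε ‖c‖² < r²`.
  obtain ⟨ε, hε0, hε1, hε⟩ : ∃ ε : ℝ, 0 < ε ∧ ε < 1 ∧ ε * ‖c‖ ^ 2 < r ^ 2 := by
    have hpos : 0 < r ^ 2 + ‖c‖ ^ 2 := by positivity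
    refine ⟨r ^ 2 / (r ^ 2 + ‖c‖ ^ 2) / 2, by positivity, ?_, ?_⟩
    · have : r ^ 2 / (r ^ 2 + ‖c‖ ^ 2) ≤ 1 := (div_le_one hpos).2 (by nlinarith [norm_nonneg c])
      linarith
    · rw [div_div, div_mul_eq_mul_div, div_lt_iff₀ (by positivity)]
      nlinarith [sq_nonneg ‖c‖, pow_pos hr 2, mul_nonneg (pow_pos hr 2).le (sq_nonneg ‖c‖),
        pow_pos hr 4]
  have hkey : ∀ x ∈ S, ‖x - (1 - ε) • c‖ ^ 2 ≤ (1 - ε) * r ^ 2 + ε * (ε * ‖c‖ ^ 2) := by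
    intro x hx
    have h1 : ‖x - c‖ ≤ r := by simpa [dist_eq_norm] using hsub hx
    have h1' : ‖x - c‖ ^ 2 ≤ r ^ 2 := pow_le_pow_left₀ (norm_nonneg _) h1 2
    have h2 : ‖x‖ ^ 2 ≤ ‖c‖ ^ 2 := pow_le_pow_left₀ (norm_nonneg _) ((hS x hx).trans hc) 2
    have h3 := norm_sub_sq_real x c
    have h4 := norm_sub_sq_real x ((1 - ε) • c)
    rw [real_inner_smul_right, norm_smul, Real.norm_of_nonneg (by linarith)] at h4
    rw [h3] at h1'
    rw [h4]
    nlinarith [mul_le_mul_of_nonneg_left h1' (sub_nonneg.2 hε1.le),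
      mul_le_mul_of_nonneg_left h2 hε0.le]
  have hle := hmin ((1 - ε) • c) (√((1 - ε) * r ^ 2 + ε * (ε * ‖c‖ ^ 2))) (Real.sqrt_nonneg _)
    fun x hx => by
      rw [Metric.mem_closedBall, dist_eq_norm]
      exact Real.le_sqrt_of_sq_le (hkey x hx)
  rw [Real.le_sqrt' hr] at hle
  nlinarith [mul_lt_mul_of_pos_left hε hε0]

theorem IsSmallestEnclosingCircle.eq_center {S : Set Plane} {c : Plane}
    (h : IsSmallestEnclosingCircle S c 0) {x : Plane} (hx : x ∈ S) : x = c := by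
  simpa using h.2.1 hx

theorem IsSmallestEnclosingCircle.norm_center_le {S : Set Plane} {c : Plane} {r R : ℝ}
    (h : IsSmallestEnclosingCircle S c r) (hS : ∀ x ∈ S, ‖x‖ ≤ R) (hne : S.Nonempty) :
    ‖c‖ ≤ R := by
  rcases h.1.eq_or_lt with rfl | hr
  · obtain ⟨x, hx⟩ := hne
    exact h.eq_center hx ▸ hS x hx
  · exact (h.norm_center_lt hr hS).le

/-- Smallest enclosing circles of convergent families of points converge to smallest enclosing
circles of the limit, as soon as their centres and radii converge. -/
theorem isSmallestEnclosingCircle_of_tendsto {ι : Type*} {s : Set ι} (hs : s.Finite)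
    {x : ℕ → ι → Plane} {y : ι → Plane} {c : ℕ → Plane} {d : Plane} {r : ℕ → ℝ} {ρ : ℝ}
    (h : ∀ m, IsSmallestEnclosingCircle (x m '' s) (c m) (r m))
    (hx : ∀ i, Tendsto (fun m => x m i) atTop (𝓝 (y i))) (hc : Tendsto c atTop (𝓝 d))
    (hr : Tendsto r atTop (𝓝 ρ)) : IsSmallestEnclosingCircle (y '' s) d ρ := by
  refine ⟨ge_of_tendsto' hr fun m => (h m).1, ?_, ?_⟩
  · rintro _ ⟨i, hi, rfl⟩
    exact le_of_tendsto_of_tendsto' ((hx i).dist hc) hr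
      fun m => (h m).2.1 (Set.mem_image_of_mem _ hi)
  · intro c' r' hr' hsub
    refine le_of_forall_pos_le_add fun ε hε => ?_
    refine le_of_tendsto hr ?_
    have : ∀ᶠ m in atTop, ∀ i ∈ s, dist (x m i) c' < r' + ε := by
      refine (eventually_all_finite hs).2 fun i hi => ?_
      refine ((hx i).dist tendsto_const_nhds).eventually_lt_const ?_
      have := hsub (Set.mem_image_of_mem y hi)
      rw [Metric.mem_closedBall] at this
      linarith
    filter_upwards [this] with m hm
    refine (h m).2.2 c' _ (by linarith) ?_
    rintro _ ⟨i, hi, rfl⟩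
    exact (hm i hi).le

/-! ### Local centres and radii -/

variable {n : ℕ} {V σ : ℝ}

theorem coe_localPositions (p : Constellation n) (i : Fin n) :
    (localPositions V p i : Set Plane) =
      p '' insert i ((visibilityGraph V p).neighborSet i) := by
  ext x
  simp [localPositions, neighbours, eq_comm (a := x)]

/-- The radius of the smallest circle enclosing agent `i` and its neighbours. -/
noncomputable def radius (V : ℝ) (p : Constellation n) (i : Fin n) : ℝ :=
  (existsUnique_smallestEnclosingCircle _ (localPositions_nonempty V p i)).choose.2

theorem isSmallestEnclosingCircle_center (p : Constellation n) (i : Fin n) :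
    IsSmallestEnclosingCircle (p '' insert i ((visibilityGraph V p).neighborSet i))
      (center V p i) (radius V p i) := by
  rw [← coe_localPositions]
  exact (existsUnique_smallestEnclosingCircle _ (localPositions_nonempty V p i)).choose_spec.1

theorem IsSmallestEnclosingCircle.radius_le {p : Constellation n} {c : Plane} {r R : ℝ}
    {s : Set (Fin n)} (h : IsSmallestEnclosingCircle (p '' s) c r) (hR : 0 ≤ R) (x : Plane)
    (hs : ∀ j ∈ s, dist (p j) x ≤ R) : r ≤ R := by
  refine h.2.2 x R hR ?_
  rintro _ ⟨j, hj, rfl⟩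
  exact hs j hj

theorem center_unique {p : Constellation n} {i : Fin n} {c : Plane} {r : ℝ}
    (h : IsSmallestEnclosingCircle (p '' insert i ((visibilityGraph V p).neighborSet i)) c r) :
    center V p i = c := by
  rw [← coe_localPositions] at h
  exact congrArg Prod.fst
    ((existsUnique_smallestEnclosingCircle _ (localPositions_nonempty V p i)).choose_spec.2
      (c, r) h).symm

theorem dist_center_le (p : Constellation n) (i : Fin n) :
    dist (p i) (center V p i) ≤ radius V p i :=
  (isSmallestEnclosingCircle_center p i).2.1
    (Set.mem_image_of_mem _ (Set.mem_insert _ _))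

theorem radius_le (hV : 0 ≤ V) (p : Constellation n) (i : Fin n) : radius V p i ≤ V := by
  refine (isSmallestEnclosingCircle_center p i).radius_le hV (p i) ?_
  rintro j (rfl | hj)
  · simpa using hV
  · rw [dist_comm]
    exact hj.2

/-! ### The limit on a step -/

/-- The largest distance that a point `x` can move towards `c` inside the closed disc of radius
`V / 2` about the midpoint of `x` and `y`, written without angles. -/
noncomputable def limitDist (V : ℝ) (c x y : Plane) : ℝ :=
  inner ℝ (c - x) (y - x) / (2 * ‖c - x‖) +
    √((V / 2) ^ 2 - (‖y - x‖ / 2) ^ 2 + (inner ℝ (c - x) (y - x) / (2 * ‖c - x‖)) ^ 2)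

theorem limitPair_eq (p : Constellation n) (i j : Fin n) :
    limitPair V p i j = limitDist V (center V p i) (p i) (p j) := by
  unfold limitPair limitDist
  have h := InnerProductGeometry.cos_angle_mul_norm_mul_norm (center V p i - p i) (p j - p i)
  have hs := Real.sin_sq_add_cos_sq (EuclideanGeometry.angle (center V p i) (p i) (p j))
  simp only [EuclideanGeometry.angle, vsub_eq_sub] at hs ⊢
  have key : ‖p j - p i‖ / 2 *
      Real.cos (InnerProductGeometry.angle (center V p i - p i) (p j - p i)) =
      inner ℝ (center V p i - p i) (p j - p i) / (2 * ‖center V p i - p i‖) := by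
    rw [← h]
    rcases eq_or_ne (‖center V p i - p i‖) 0 with h0 | h0
    · simp [norm_eq_zero.1 h0]
    · field_simp
  rw [← key]
  congr 2
  linear_combination (-(‖p j - p i‖ / 2) ^ 2) * hs

theorem limitDist_nonneg (hV : 0 ≤ V) {c x y : Plane} (h : ‖y - x‖ ≤ V) :
    0 ≤ limitDist V c x y := by
  unfold limitDist
  set a := inner ℝ (c - x) (y - x) / (2 * ‖c - x‖)
  have : |a| ≤ √((V / 2) ^ 2 - (‖y - x‖ / 2) ^ 2 + a ^ 2) := by
    apply Real.abs_le_sqrt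
    nlinarith [norm_nonneg (y - x)]
  linarith [neg_abs_le a]

/-- If the angle at `x` is not acute, then `‖y - x‖² < ‖y - c‖² ≤ V²`, so `x` is interior to the
disc; if it is acute, the first summand is positive. -/
theorem limitDist_pos (hV : 0 < V) {c x y : Plane} (hc : c ≠ x)
    (hy : dist y c ≤ V) : 0 < limitDist V c x y := by
  have hcx : 0 < ‖c - x‖ := norm_pos_iff.2 (sub_ne_zero.2 hc)
  unfold limitDist
  set a := inner ℝ (c - x) (y - x) / (2 * ‖c - x‖) with ha
  rcases lt_or_ge 0 a with h0 | h0
  · positivity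
  have hin : inner ℝ (c - x) (y - x) ≤ 0 := by
    by_contra! hpos
    exact absurd h0 (not_le.2 (by positivity))
  have hlt : ‖y - x‖ ^ 2 < V ^ 2 := by
    have h1 := norm_sub_sq_real (c - x) (y - x)
    rw [sub_sub_sub_cancel_right, ← dist_eq_norm, dist_comm] at h1
    nlinarith [dist_nonneg (x := y) (y := c)]
  have : -a < √((V / 2) ^ 2 - (‖y - x‖ / 2) ^ 2 + a ^ 2) := by
    apply Real.lt_sqrt_of_sq_lt
    nlinarith
  linarith

theorem le_limitDist {c x y : Plane} (h : ‖y - x‖ ≤ V) :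
    V / 2 - ‖y - x‖ ≤ limitDist V c x y := by
  unfold limitDist
  set a := inner ℝ (c - x) (y - x) / (2 * ‖c - x‖) with ha
  have h0 := norm_nonneg (y - x)
  have h1 : |a| ≤ ‖y - x‖ / 2 := by
    rw [ha, abs_div, abs_of_nonneg (by positivity : 0 ≤ 2 * ‖c - x‖)]
    apply div_le_of_le_mul₀ (by positivity) (by positivity)
    nlinarith [abs_real_inner_le_norm (c - x) (y - x)]
  have h2 : V / 2 - ‖y - x‖ / 2 ≤ √((V / 2) ^ 2 - (‖y - x‖ / 2) ^ 2 + a ^ 2) := by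
    apply Real.le_sqrt_of_sq_le
    nlinarith [sq_nonneg a]
  linarith [neg_abs_le a]

/-- A point that moves towards `c` by at most `limitDist` stays in the disc of radius `V / 2` about
the midpoint. -/
theorem dist_midpoint_le (hV : 0 ≤ V) {c x y : Plane} {s : ℝ} (h : ‖y - x‖ ≤ V) (hs : 0 ≤ s)
    (hs' : s ≤ limitDist V c x y) :
    dist (x + (s / ‖c - x‖) • (c - x)) (midpoint ℝ x y) ≤ V / 2 := by
  have hm : x + (s / ‖c - x‖) • (c - x) - midpoint ℝ x y =
      (s / ‖c - x‖) • (c - x) - (2 : ℝ)⁻¹ • (y - x) := by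
    rw [midpoint_eq_smul_add]
    simp only [invOf_eq_inv]
    module
  rw [dist_eq_norm, hm]
  refine le_of_sq_le_sq ?_ (by positivity)
  rcases eq_or_ne c x with rfl | hc
  · simp only [sub_self, norm_zero, div_zero, smul_zero, zero_sub, norm_neg, norm_smul]
    rw [Real.norm_of_nonneg (by norm_num)]
    nlinarith [norm_nonneg (y - c)]
  have hcx : 0 < ‖c - x‖ := norm_pos_iff.2 (sub_ne_zero.2 hc)
  unfold limitDist at hs'
  set a := inner ℝ (c - x) (y - x) / (2 * ‖c - x‖) with ha
  have hD : a ^ 2 ≤ (V / 2) ^ 2 - (‖y - x‖ / 2) ^ 2 + a ^ 2 := by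
    nlinarith [norm_nonneg (y - x)]
  have h1 := Real.abs_le_sqrt hD
  -- Completing the square, membership in the disc is `(s - a)² ≤ (V/2)² - (‖y - x‖/2)² + a²`.
  have h2 : |s - a| ≤ √((V / 2) ^ 2 - (‖y - x‖ / 2) ^ 2 + a ^ 2) :=
    abs_le.2 ⟨by linarith [le_abs_self a], by linarith⟩
  have h3 := sq_le_sq' (neg_le_of_abs_le h2) (le_of_abs_le h2)
  rw [Real.sq_sqrt ((sq_nonneg a).trans hD)] at h3
  rw [norm_sub_sq_real, real_inner_smul_left, real_inner_smul_right, norm_smul, norm_smul,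
    Real.norm_of_nonneg (by positivity : 0 ≤ s / ‖c - x‖), div_mul_cancel₀ _ hcx.ne',
    Real.norm_of_nonneg (by norm_num : (0 : ℝ) ≤ 2⁻¹)]
  have h4 : s / ‖c - x‖ * (2⁻¹ * inner ℝ (c - x) (y - x)) = s * a := by
    rw [ha]; field_simp
  rw [h4]
  nlinarith

/-! ### Preservation of visibility -/

theorem norm_sub_le_of_adj {p : Constellation n} {i j : Fin n}
    (h : (visibilityGraph V p).Adj i j) : ‖p j - p i‖ ≤ V := by
  rw [← dist_eq_norm, dist_comm]
  exact h.2

theorem le_step_iff {p : Constellation n} {i : Fin n} {s : ℝ} :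
    s ≤ step V σ p i ↔ s ≤ σ ∧ s ≤ goal V p i ∧ ∀ j, (visibilityGraph V p).Adj i j →
      s ≤ limitDist V (center V p i) (p i) (p j) := by
  simp [step, Finset.le_min'_iff, neighbours, limitPair_eq]

theorem step_nonneg (hV : 0 ≤ V) (hσ : 0 ≤ σ) (p : Constellation n) (i : Fin n) :
    0 ≤ step V σ p i :=
  le_step_iff.2 ⟨hσ, norm_nonneg _, fun _ hj => limitDist_nonneg hV (norm_sub_le_of_adj hj)⟩

/-- Both agents stay in one disc of diameter `V`, centred at their old midpoint. -/
theorem visibilityGraph_le_next (hV : 0 ≤ V) (hσ : 0 ≤ σ) (p : Constellation n) :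
    visibilityGraph V p ≤ visibilityGraph V (nextPosition V σ p) := by
  intro i j h
  have hi := dist_midpoint_le hV (norm_sub_le_of_adj h) (step_nonneg hV hσ p i)
    ((le_step_iff.1 le_rfl).2.2 j h)
  have hj := dist_midpoint_le hV (norm_sub_le_of_adj h.symm) (step_nonneg hV hσ p j)
    ((le_step_iff.1 le_rfl).2.2 i h.symm)
  rw [midpoint_comm] at hj
  refine ⟨h.1, (dist_triangle_right _ _ (midpoint ℝ (p i) (p j))).trans ?_⟩
  unfold nextPosition
  linarith

/-! ### Distance from the origin -/

/-- The fraction of the way to its centre that agent `i` moves. -/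
noncomputable def ratio (V σ : ℝ) (p : Constellation n) (i : Fin n) : ℝ :=
  step V σ p i / ‖center V p i - p i‖

theorem ratio_mem (hV : 0 ≤ V) (hσ : 0 ≤ σ) (p : Constellation n) (i : Fin n) :
    ratio V σ p i ∈ Set.Icc (0 : ℝ) 1 := by
  refine ⟨div_nonneg (step_nonneg hV hσ p i) (norm_nonneg _),
    div_le_one_of_le₀ ?_ (norm_nonneg _)⟩
  rw [norm_sub_rev]
  exact (le_step_iff.1 le_rfl).2.1

theorem norm_center_le (p : Constellation n) (i : Fin n) : ‖center V p i‖ ≤ ‖p‖ := by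
  refine (isSmallestEnclosingCircle_center p i).norm_center_le ?_ ⟨p i, i, by simp⟩
  rintro _ ⟨j, -, rfl⟩
  exact norm_le_pi_norm p j

theorem norm_move_le {x c : Plane} {t R : ℝ} (ht : t ∈ Set.Icc (0 : ℝ) 1) (hx : ‖x‖ ≤ R)
    (hc : ‖c‖ ≤ R) : ‖x + t • (c - x)‖ ≤ R := by
  have h : x + t • (c - x) = (1 - t) • x + t • c := by module
  rw [h]
  refine (norm_add_le _ _).trans ?_
  rw [norm_smul, norm_smul, Real.norm_of_nonneg ht.1, Real.norm_of_nonneg (sub_nonneg.2 ht.2)]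
  nlinarith [mul_le_mul_of_nonneg_left hx (sub_nonneg.2 ht.2), mul_le_mul_of_nonneg_left hc ht.1]

theorem norm_move_lt {x c : Plane} {t R : ℝ} (ht : t ∈ Set.Icc (0 : ℝ) 1) (hx : ‖x‖ ≤ R)
    (hc : ‖c‖ < R) (h : ‖x‖ < R ∨ 0 < t) : ‖x + t • (c - x)‖ < R := by
  have h' : x + t • (c - x) = (1 - t) • x + t • c := by module
  rw [h']
  refine (norm_add_le _ _).trans_lt ?_
  rw [norm_smul, norm_smul, Real.norm_of_nonneg ht.1, Real.norm_of_nonneg (sub_nonneg.2 ht.2)]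
  rcases ht.1.eq_or_lt with rfl | h0
  · simpa using h
  · nlinarith [mul_le_mul_of_nonneg_left hx (sub_nonneg.2 ht.2), mul_lt_mul_of_pos_left hc h0]

theorem norm_nextPosition_le (hV : 0 ≤ V) (hσ : 0 ≤ σ) (p : Constellation n) :
    ‖nextPosition V σ p‖ ≤ ‖p‖ :=
  (pi_norm_le_iff_of_nonneg (norm_nonneg p)).2 fun i =>
    norm_move_le (ratio_mem hV hσ p i) (norm_le_pi_norm p i) (norm_center_le p i)

/-! ### Gathering in one step -/

/-- Agents that are all close to each other meet after one time-step. -/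
theorem nextPosition_eq_of_close (hV : 0 < V) (p : Constellation n) {δ : ℝ}
    (hδσ : δ ≤ σ) (hδV : δ ≤ V / 4) (h : ∀ i j, dist (p i) (p j) ≤ δ) :
    ∃ q, ∀ i, nextPosition V σ p i = q := by
  rcases isEmpty_or_nonempty (Fin n) with hn | ⟨⟨i₀⟩⟩
  · exact ⟨0, fun i => hn.elim i⟩
  have hδ : 0 ≤ δ := dist_nonneg.trans (h i₀ i₀)
  have huniv : ∀ i, insert i ((visibilityGraph V p).neighborSet i) = Set.univ := fun i =>
    Set.eq_univ_of_forall fun j => (eq_or_ne j i).imp id fun hj =>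
      ⟨hj.symm, (h i j).trans (by linarith)⟩
  refine ⟨center V p i₀, fun i => ?_⟩
  have hc : center V p i = center V p i₀ := center_unique (r := radius V p i₀) (by
    rw [huniv, ← huniv i₀]
    exact isSmallestEnclosingCircle_center p i₀)
  have hgoal : goal V p i ≤ δ := by
    rw [goal, ← dist_eq_norm]
    exact (dist_center_le p i).trans
      ((isSmallestEnclosingCircle_center p i).radius_le hδ (p i₀) fun j _ => h j i₀)
  have hstep : step V σ p i = goal V p i := by
    refine le_antisymm (le_step_iff.1 le_rfl).2.1
      (le_step_iff.2 ⟨hgoal.trans hδσ, le_rfl, fun j hj => ?_⟩)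
    -- The limit is at least `V/2 - δ ≥ V/4 ≥ δ`, so the goal is the binding term.
    have h1 := le_limitDist (c := center V p i) (norm_sub_le_of_adj hj)
    have h2 := h j i
    rw [dist_eq_norm] at h2
    linarith
  rw [nextPosition, hstep, goal, norm_sub_rev, ← hc]
  rcases eq_or_ne (center V p i) (p i) with h0 | h0
  · simp [h0]
  · rw [div_self (norm_ne_zero_iff.2 (sub_ne_zero.2 h0)), one_smul, add_sub_cancel]

/-- Agents that have met do not move any more. -/
theorem nextPosition_eq_of_gathered {p : Constellation n} {q : Plane} (h : ∀ i, p i = q)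
    (i : Fin n) : nextPosition V σ p i = q := by
  have hr : radius V p i ≤ 0 :=
    (isSmallestEnclosingCircle_center p i).radius_le le_rfl q fun j _ => by simp [h j]
  have hc : p i = center V p i := dist_le_zero.1 ((dist_center_le p i).trans hr)
  rw [nextPosition, ← hc, sub_self, smul_zero, add_zero, h i]

/-! ### Moves along a fixed graph -/

/-- Moves of all agents towards their centres, along a fixed graph `G`, from `x` to `y`. -/
def IsMove (G : SimpleGraph (Fin n)) (x y : Constellation n) : Prop :=
  ∀ i, ∃ (c : Plane) (r t : ℝ), IsSmallestEnclosingCircle (x '' insert i (G.neighborSet i)) c r ∧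
    t ∈ Set.Icc (0 : ℝ) 1 ∧ y i = x i + t • (c - x i) ∧ (c ≠ x i → 0 < t)

/-- A positive radius puts the centre strictly inside the disc of radius `‖x‖`, and the agent is at
the centre or moves a positive fraction towards it. Radius zero means that all the enclosed agents
coincide. -/
theorem IsMove.norm_lt_or {G : SimpleGraph (Fin n)} {x y : Constellation n} (h : IsMove G x y)
    (i : Fin n) : ‖y i‖ < ‖x‖ ∨ y i = x i ∧ ∀ j, G.Adj i j → x j = x i := by
  obtain ⟨c, r, t, hc, ht, hy, hpos⟩ := h i
  rcases hc.1.eq_or_lt with rfl | hr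
  · right
    have h0 : x i = c := hc.eq_center (Set.mem_image_of_mem x (Set.mem_insert _ _))
    refine ⟨by rw [hy, h0]; simp, fun j hj => ?_⟩
    rw [h0]
    exact hc.eq_center (Set.mem_image_of_mem x (Set.mem_insert_of_mem _ hj))
  · left
    have hlt : ‖c‖ < ‖x‖ := hc.norm_center_lt hr (by
      rintro _ ⟨j, -, rfl⟩
      exact norm_le_pi_norm x j)
    rw [hy]
    refine norm_move_lt ht (norm_le_pi_norm x i) hlt ?_
    rcases eq_or_ne c (x i) with rfl | hne
    · exact Or.inl hlt
    · exact Or.inr (hpos hne)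

/-- A sequence of moves along a connected graph that never decreases the greatest distance from
the origin reaches a gathered constellation. -/
theorem exists_gathered_of_norm_eq {G : SimpleGraph (Fin n)} (hG : G.Connected)
    {q : ℕ → Constellation n} (hq : ∀ j, IsMove G (q j) (q (j + 1))) {L : ℝ}
    (hL : ∀ j, ‖q j‖ = L) : ∃ j z, ∀ i, q j i = z := by
  classical
  have := hG.nonempty
  let A : ℕ → Finset (Fin n) := fun j => {i | ‖q j i‖ = L}
  have hstep : ∀ j i, i ∈ A (j + 1) → q (j + 1) i = q j i ∧ ∀ l, G.Adj i l → q j l = q j i := by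
    intro j i hi
    refine ((hq j).norm_lt_or i).resolve_left ?_
    rw [hL, (Finset.mem_filter.1 hi).2]
    exact lt_irrefl L
  have hanti : Antitone A := antitone_nat_of_succ_le fun j i hi => by
    have h1 := (Finset.mem_filter.1 hi).2
    rw [(hstep j i hi).1] at h1
    simpa [A] using h1
  -- The extremal sets shrink, hence stabilise; extremality then spreads from `i₀` along walks.
  obtain ⟨j, hj⟩ := WellFoundedGT.monotone_chain_condition
    (⟨fun j => OrderDual.toDual (A j), hanti⟩ : ℕ →o (Finset (Fin n))ᵒᵈ)
  have hj : A j = A (j + 1) := hj (j + 1) (Nat.le_succ j)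
  obtain ⟨i₀, hi₀⟩ : ∃ i, ‖q j i‖ = L := by
    obtain ⟨i, hi⟩ := Finite.exists_max fun i => ‖q j i‖
    refine ⟨i, le_antisymm (hL j ▸ norm_le_pi_norm _ _) ?_⟩
    rw [← hL j]
    exact (pi_norm_le_iff_of_nonneg (norm_nonneg _)).2 hi
  refine ⟨j, q j i₀, fun i => ?_⟩
  obtain ⟨w⟩ := hG.preconnected i i₀
  induction w with
  | nil => rfl
  | @cons u v w huv _ ih =>
    have hv := ih hi₀
    have hvA : v ∈ A (j + 1) := by
      rw [← hj]
      simp [A, hv, hi₀]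
    rw [(hstep j v hvA).2 u huv.symm, hv]

/-! ### Passage to the limit -/

theorem continuousAt_limitDist {c x y : Plane} (h : c ≠ x) :
    ContinuousAt (fun z : Plane × Plane × Plane => limitDist V z.1 z.2.1 z.2.2) (c, x, y) := by
  have h0 : 2 * ‖c - x‖ ≠ 0 := mul_ne_zero two_ne_zero (norm_ne_zero_iff.2 (sub_ne_zero.2 h))
  unfold limitDist
  fun_prop (disch := exact h0)

/-- Limits of time-steps with a constant visibility graph are moves along this graph. -/
theorem isMove_of_tendsto (hV : 0 < V) (hσ : 0 < σ) {G : SimpleGraph (Fin n)}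
    {x : ℕ → Constellation n} {y y' : Constellation n} {c : Constellation n} {r t : Fin n → ℝ}
    (hG : ∀ m, visibilityGraph V (x m) = G)
    (hx : ∀ i, Tendsto (fun m => x m i) atTop (𝓝 (y i)))
    (hx' : ∀ i, Tendsto (fun m => nextPosition V σ (x m) i) atTop (𝓝 (y' i)))
    (hc : ∀ i, Tendsto (fun m => center V (x m) i) atTop (𝓝 (c i)))
    (hr : ∀ i, Tendsto (fun m => radius V (x m) i) atTop (𝓝 (r i)))
    (ht : ∀ i, Tendsto (fun m => ratio V σ (x m) i) atTop (𝓝 (t i))) : IsMove G y y' := by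
  intro i
  have hsec : IsSmallestEnclosingCircle (y '' insert i (G.neighborSet i)) (c i) (r i) :=
    isSmallestEnclosingCircle_of_tendsto (Set.toFinite _)
      (fun m => by rw [← hG m]; exact isSmallestEnclosingCircle_center (x m) i) hx (hc i) (hr i)
  refine ⟨c i, r i, t i, hsec, isClosed_Icc.mem_of_tendsto (ht i)
    (Eventually.of_forall fun m => ratio_mem hV.le hσ.le (x m) i),
    tendsto_nhds_unique (hx' i) ((hx i).add ((ht i).smul ((hc i).sub (hx i)))), fun hne => ?_⟩
  -- This keeps neighbours within `V` of the limit centre, as `limitDist_pos` requires.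
  have hrV : r i ≤ V := le_of_tendsto' (hr i) fun m => radius_le hV.le (x m) i
  have hpos : 0 < ‖c i - y i‖ := norm_pos_iff.2 (sub_ne_zero.2 hne)
  have hlim : ∀ j, G.Adj i j → 0 < limitDist V (c i) (y i) (y j) := fun j hj =>
    limitDist_pos hV hne
      ((hsec.2.1 (Set.mem_image_of_mem y (Set.mem_insert_of_mem _ hj))).trans hrV)
  obtain ⟨δ, hδ, hδ0⟩ : ∃ δ, (δ < σ ∧ δ < ‖c i - y i‖ ∧
      ∀ j, G.Adj i j → δ < limitDist V (c i) (y i) (y j)) ∧ 0 < δ := by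
    have h1 : ∀ {a : ℝ}, 0 < a → ∀ᶠ δ in 𝓝[>] (0 : ℝ), δ < a := fun ha =>
      nhdsWithin_le_nhds (eventually_lt_nhds ha)
    have h2 : ∀ᶠ δ in 𝓝[>] (0 : ℝ), ∀ j, G.Adj i j → δ < limitDist V (c i) (y i) (y j) :=
      eventually_all.2 fun j => eventually_imp_distrib_left.2 fun hj => h1 (hlim j hj)
    exact (((h1 hσ).and ((h1 hpos).and h2)).and self_mem_nhdsWithin).exists
  have hn : Tendsto (fun m => ‖center V (x m) i - x m i‖) atTop (𝓝 ‖c i - y i‖) :=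
    ((hc i).sub (hx i)).norm
  have hev : ∀ᶠ m in atTop, ∀ j, G.Adj i j →
      δ < limitDist V (center V (x m) i) (x m i) (x m j) :=
    eventually_all.2 fun j => eventually_imp_distrib_left.2 fun hj =>
      ((continuousAt_limitDist hne).tendsto.comp
        ((hc i).prodMk_nhds ((hx i).prodMk_nhds (hx j)))).eventually_const_lt (hδ.2.2 j hj)
  have hle : δ ≤ t i * ‖c i - y i‖ := by
    refine ge_of_tendsto ((ht i).mul hn) ?_
    filter_upwards [hev, hn.eventually_const_lt hδ.2.1] with m hm hm'
    rw [ratio, div_mul_cancel₀ _ (hδ0.trans hm').ne']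
    refine le_step_iff.2 ⟨hδ.1.le, ?_, fun j hj => (hm j (hG m ▸ hj)).le⟩
    rw [goal, norm_sub_rev]
    exact hm'.le
  exact pos_of_mul_pos_left (hδ0.trans_le hle) hpos.le

/-- The agents get arbitrarily close to each other. -/
theorem exists_close (hV : 0 < V) (hσ : 0 < σ) {p : ℕ → Constellation n}
    (hp : IsTrajectory V σ p) (hconn : (visibilityGraph V (p 0)).Connected) {δ : ℝ} (hδ : 0 < δ) :
    ∃ k, ∀ i j, dist (p k i) (p k j) ≤ δ := by
  have hp' : ∀ k, p (k + 1) = nextPosition V σ (p k) := fun k => funext (hp k)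
  have hmono : Monotone fun k => visibilityGraph V (p k) := monotone_nat_of_le_succ fun k => by
    rw [hp' k]
    exact visibilityGraph_le_next hV.le hσ.le (p k)
  have hanti : Antitone fun k => ‖p k‖ := antitone_nat_of_succ_le fun k => by
    rw [hp' k]
    exact norm_nextPosition_le hV.le hσ.le (p k)
  obtain ⟨K, hK⟩ := WellFoundedGT.monotone_chain_condition
    (⟨fun k => visibilityGraph V (p k), hmono⟩ : ℕ →o SimpleGraph (Fin n))
  have hK : ∀ k, K ≤ k → visibilityGraph V (p k) = visibilityGraph V (p K) :=
    fun k hk => (hK k hk).symm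
  let D : Constellation n → Fin n → Plane × Plane × ℝ × ℝ := fun x i =>
    (x i, center V x i, radius V x i, ratio V σ x i)
  have hcomp : IsCompact (Set.univ.pi fun _ : ℕ => Set.univ.pi fun _ : Fin n =>
      Metric.closedBall (0 : Plane) ‖p 0‖ ×ˢ Metric.closedBall (0 : Plane) ‖p 0‖ ×ˢ
        Set.Icc 0 V ×ˢ Set.Icc (0 : ℝ) 1) :=
    isCompact_univ_pi fun _ => isCompact_univ_pi fun _ =>
      (isCompact_closedBall _ _).prod ((isCompact_closedBall _ _).prod
        (isCompact_Icc.prod isCompact_Icc))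
  -- A single `φ` serves all shifts `j`, so the limits for `j` and `j + 1` are linked by a move.
  obtain ⟨d, -, φ, hφ, hd⟩ := hcomp.tendsto_subseq (x := fun m j => D (p (K + m + j)))
    fun m j _ i _ => by
      have h0 := hanti (Nat.zero_le (K + m + j))
      exact ⟨mem_closedBall_zero_iff.2 ((norm_le_pi_norm (p (K + m + j)) i).trans h0),
        mem_closedBall_zero_iff.2 ((norm_center_le _ _).trans h0),
        ⟨dist_nonneg.trans (dist_center_le _ i), radius_le hV.le _ _⟩,
        ratio_mem hV.le hσ.le _ _⟩
  have hd' : ∀ j i, Tendsto (fun m => D (p (K + φ m + j)) i) atTop (𝓝 (d j i)) := fun j i =>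
    tendsto_pi_nhds.1 (tendsto_pi_nhds.1 hd j) i
  let q : ℕ → Constellation n := fun j i => (d j i).1
  have hq : ∀ j, Tendsto (fun m => p (K + φ m + j)) atTop (𝓝 (q j)) := fun j =>
    tendsto_pi_nhds.2 fun i => (hd' j i).fst_nhds
  have hmove : ∀ j, IsMove (visibilityGraph V (p K)) (q j) (q (j + 1)) := fun j =>
    isMove_of_tendsto hV hσ (x := fun m => p (K + φ m + j)) (fun m => hK _ (by omega))
      (fun i => (hd' j i).fst_nhds)
      (fun i => by
        simp_rw [← hp']
        exact (hd' (j + 1) i).fst_nhds)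
      (fun i => (hd' j i).snd_nhds.fst_nhds) (fun i => (hd' j i).snd_nhds.snd_nhds.fst_nhds)
      (fun i => (hd' j i).snd_nhds.snd_nhds.snd_nhds)
  have hnorm : ∀ j, ‖q j‖ = ⨅ k, ‖p k‖ := fun j =>
    tendsto_nhds_unique (hq j).norm
      ((tendsto_atTop_ciInf hanti ⟨0, by rintro _ ⟨k, rfl⟩; exact norm_nonneg _⟩).comp
        (tendsto_atTop_mono (fun m => (by omega : φ m ≤ K + φ m + j)) hφ.tendsto_atTop))
  obtain ⟨j, z, hz⟩ := exists_gathered_of_norm_eq (hconn.mono (hmono (Nat.zero_le K))) hmove hnorm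
  have hev : ∀ᶠ m in atTop, ∀ i, dist (p (K + φ m + j) i) z < δ / 2 :=
    eventually_all.2 fun i => by
      have := tendsto_pi_nhds.1 (hq j) i
      rw [hz i] at this
      exact Metric.tendsto_nhds.1 this _ (half_pos hδ)
  obtain ⟨m, hm⟩ := hev.exists
  exact ⟨_, fun i l => (dist_triangle_right _ _ z).trans (by linarith [hm i, hm l])⟩

end AndoGathering

theorem mainTheorem2 (n : ℕ) (V σ : ℝ) (hV : 0 < V) (hσ : 0 < σ)
    (p : ℕ → AndoGathering.Constellation n) (hp : AndoGathering.IsTrajectory V σ p)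
    (hconn : (AndoGathering.visibilityGraph V (p 0)).Connected) :
    ∃ (q : AndoGathering.Plane) (K : ℕ), ∀ k : ℕ, K ≤ k → ∀ i : Fin n, p k i = q := by
  obtain ⟨k, hk⟩ := AndoGathering.exists_close hV hσ hp hconn
    (δ := min σ (V / 4)) (lt_min hσ (by positivity))
  obtain ⟨q, hq⟩ := AndoGathering.nextPosition_eq_of_close hV (p k) (min_le_left σ (V / 4))
    (min_le_right σ (V / 4)) hk
  refine ⟨q, k + 1, fun m hm => ?_⟩
  induction m, hm using Nat.le_induction with
  | base => exact fun i => (hp k i).trans (hq i)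
  | succ m _ ih =>
    exact fun i => (hp m i).trans (AndoGathering.nextPosition_eq_of_gathered ih i)
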